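/- Let $V$ be a valuation domain of rank one with quotient field $K$ and associated (additively written) valuation $v$, let $\overline{K}$ be an algebraic closure of $K$, let $u$ be an extension of $v$ to $\overline{K}$, and let $\beta\in\overline{K}$. Let $\mathrm{Zar}(K(X)|V)$ be the set of valuation domains of $K(X)$ containing $V$. Its Zariski topology is the topology generated by the sets $B(\phi)=\{W\in\mathrm{Zar}(K(X)|V)\mid\phi\in W\}$, $\phi\in K(X)$, and its constructible topology is the coarsest topology in which all finite intersections $B(\phi_1)\cap\cdots\cap B(\phi_k)$ are both open and closed. A sequence $E=\{s_n\}_{n\in\mathbb{N}}\subseteq K$ is pseudo-convergent if $v(s_{n+1}-s_n)<v(s_{n+2}-s_{n+1})$ for all $n$; in this case $$V_E=\{\phi\in K(X)\mid \phi(s_n)\in V\text{ for all but finitely many }n\}$$ is a valuation domain in $\mathrm{Zar}(K(X)|V)$. An element $\beta\in\overline{K}$ is a pseudo-limit of $E$ with respect to $u$ if $u(\beta-s_n)<u(\beta-s_{n+1})$ for all $n$. Let $$\mathcal{V}^u(\beta,\bullet)=\{V_E\mid E\subseteq K\text{ is a pseudo-convergent sequence having }\beta\text{ as a pseudo-limit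 with respect to }u\}.$$ Then the Zariski topology and the constructible topology of $\mathrm{Zar}(K(X)|V)$ induce the same subspace topology on $\mathcal{V}^u(\beta,\bullet)$. -/

import Mathlib

open Polynomial Filter

namespace ZarSpace

/-! ### The Zariski space and its two topologies -/

/-- The Zariski space `Zar(L|D)`: the valuation domains of the field `L` that contain
(the image of) `D`. -/
def Zar (D L : Type*) [CommRing D] [Field L] [Algebra D L] : Type _ :=
  {W : ValuationSubring L // ∀ d : D, algebraMap D L d ∈ W}

section Topologies

variable (D L : Type*) [CommRing D] [Field L] [Algebra D L]

/-- The set `B(φ)` of the `W ∈ Zar(L|D)` with `φ ∈ W`. -/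
def B (φ : L) : Set (Zar D L) := {W | φ ∈ W.1}

/-- The Zariski topology on `Zar(L|D)`, with subbasis the sets `B(φ)`. -/
@[reducible]
def zariskiTopology : TopologicalSpace (Zar D L) :=
  TopologicalSpace.generateFrom (Set.range (B D L))

/-- The constructible topology on `Zar(L|D)`: the coarsest topology for which all the finite
intersections `B(φ₁, …, φₖ) = B(φ₁) ∩ ⋯ ∩ B(φₖ)` are both open and closed. -/
@[reducible]
def constructibleTopology : TopologicalSpace (Zar D L) :=
  TopologicalSpace.generateFrom
    {U | ∃ s : Finset L, U = (⋂ φ ∈ s, B D L φ) ∨ U = (⋂ φ ∈ s, B D L φ)ᶜ}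

end Topologies

/-! ### Pseudo-convergent sequences

Valuations are written multiplicatively, so the inequalities are the reverse of the ones in
additive notation. -/

section Sequences

variable {K : Type*} [Field K] {Γ₀ : Type*} [LinearOrderedCommGroupWithZero Γ₀]

/-- `s` is pseudo-convergent: in additive notation, `v (s_{n+1} - s_n) < v (s_{n+2} - s_{n+1})`
for all `n`. -/
def IsPseudoConvergent (v : Valuation K Γ₀) (s : ℕ → K) : Prop :=
  ∀ n, v (s (n + 2) - s (n + 1)) < v (s (n + 1) - s n)

/-- `β` (in an extension `L` of `K` with a valuation `u`) is a pseudo-limit of `s` with respect to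
`u`: in additive notation, `u (β - s_n) < u (β - s_{n+1})` for all `n`. -/
def IsPseudoLimit {L : Type*} [Field L] [Algebra K L] {Γ : Type*}
    [LinearOrderedCommGroupWithZero Γ] (u : Valuation L Γ) (s : ℕ → K) (β : L) : Prop :=
  ∀ n, u (β - algebraMap K L (s (n + 1))) < u (β - algebraMap K L (s n))

/-- A valuation extends to a valuation on an algebraic closure. -/
theorem exists_extension (v : Valuation K Γ₀) :
    ∃ A : ValuationSubring (AlgebraicClosure K), v.HasExtension A.valuation := by
  obtain ⟨A, h, hloc⟩ := IsLocalRing.exists_factor_valuationRing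
    ((algebraMap K (AlgebraicClosure K)).comp v.valuationSubring.subtype)
  refine ⟨A, ⟨Valuation.isEquiv_of_val_le_one fun x => ?_⟩⟩
  rw [Valuation.comap_apply, ValuationSubring.valuation_le_one_iff]
  refine ⟨fun hx => h ⟨x, hx⟩, fun hx => ?_⟩
  by_contra hlt
  have hlt : 1 < v x := not_le.1 hlt
  have hx0 : x ≠ 0 := by rintro rfl; simp at hlt
  have hi : v x⁻¹ < 1 := by rw [map_inv₀]; exact inv_lt_one_of_one_lt₀ hlt
  have hu : IsUnit (⟨x⁻¹, hi.le⟩ : v.valuationSubring) := by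
    apply hloc.map_nonunit
    refine IsUnit.of_mul_eq_one (⟨_, hx⟩ : A.toSubring) (Subtype.ext ?_)
    change algebraMap K (AlgebraicClosure K) x⁻¹ * algebraMap K (AlgebraicClosure K) x = 1
    rw [← map_mul, inv_mul_cancel₀ hx0, map_one]
  obtain ⟨⟨y, hy⟩, hxy⟩ := hu.exists_right_inv
  have hxy' : x⁻¹ * y = 1 := congrArg Subtype.val hxy
  have hyx : y = x := by field_simp at hxy'; exact hxy'
  exact absurd hlt (not_lt.2 (hyx ▸ hy))

namespace IsPseudoConvergent

theorem map {v : Valuation K Γ₀} {s : ℕ → K} (hs : IsPseudoConvergent v s)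
    {L : Type*} [Field L] [Algebra K L] {Γ : Type*} [LinearOrderedCommGroupWithZero Γ]
    (u : Valuation L Γ) [v.HasExtension u] :
    IsPseudoConvergent u (fun n => algebraMap K L (s n)) := by
  intro n
  simp only [← map_sub]
  exact (Valuation.HasExtension.val_map_lt_iff v u _ _).2 (hs n)

variable {v : Valuation K Γ₀} {s : ℕ → K}

theorem gauge_strictAnti (hs : IsPseudoConvergent v s) :
    StrictAnti (fun n => v (s (n + 1) - s n)) :=
  strictAnti_nat_of_succ_lt fun n => hs n

theorem gauge_ne_zero (hs : IsPseudoConvergent v s) (n : ℕ) : v (s (n + 1) - s n) ≠ 0 :=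
  ne_of_gt (lt_of_le_of_lt zero_le (hs n))

theorem val_sub (hs : IsPseudoConvergent v s) (m k : ℕ) :
    v (s (m + 1 + k) - s m) = v (s (m + 1) - s m) := by
  induction k with
  | zero => rfl
  | succ k ih =>
    have h : s (m + 1 + (k + 1)) - s m
        = (s (m + 1 + k) - s m) + (s (m + 1 + k + 1) - s (m + 1 + k)) := by
      rw [← add_assoc]; ring
    rw [h, Valuation.map_add_eq_of_lt_left, ih]
    rw [ih]
    exact hs.gauge_strictAnti (by omega)

theorem eventually_linear (hs : IsPseudoConvergent v s) (α : K) :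
    ∃ (c : Γ₀) (k : ℕ), c ≠ 0 ∧ ∀ᶠ n in atTop, v (s n - α) = c * v (s (n + 1) - s n) ^ k := by
  by_cases h : ∀ n, v (s (n + 1) - α) < v (s n - α)
  · refine ⟨1, 1, one_ne_zero, Eventually.of_forall fun n => ?_⟩
    have e : s (n + 1) - s n = (s (n + 1) - α) - (s n - α) := by ring
    rw [e, one_mul, pow_one, Valuation.map_sub_swap v (s (n + 1) - α),
      Valuation.map_sub_eq_of_lt_left _ (h n)]
  · push Not at h
    obtain ⟨N, hN⟩ := h
    have h1 : v (s (N + 1) - s N) ≤ v (s (N + 1) - α) := by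
      have e : s (N + 1) - s N = (s (N + 1) - α) - (s N - α) := by ring
      rw [e]
      exact (Valuation.map_sub _ _ _).trans (max_le le_rfl hN)
    refine ⟨v (s (N + 1) - α), 0, ?_, ?_⟩
    · exact ne_of_gt (lt_of_lt_of_le (zero_lt_iff.2 (hs.gauge_ne_zero N)) h1)
    · filter_upwards [eventually_ge_atTop (N + 2)] with n hn
      obtain ⟨k, rfl⟩ := Nat.exists_eq_add_of_le hn
      have h2 := hs.val_sub (N + 1) k
      have e : s (N + 2 + k) - α = (s (N + 1) - α) + (s (N + 1 + 1 + k) - s (N + 1)) := by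
        rw [show N + 1 + 1 + k = N + 2 + k by omega]; ring
      rw [e, pow_zero, mul_one, Valuation.map_add_eq_of_lt_left]
      rw [h2]
      exact lt_of_lt_of_le (hs N) h1

theorem eventually_eval_of_splits (hs : IsPseudoConvergent v s) {p : K[X]} (hp : p.Splits)
    (hp0 : p ≠ 0) : ∃ (c : Γ₀) (k : ℕ), c ≠ 0 ∧
      ∀ᶠ n in atTop, v (p.eval (s n)) = c * v (s (n + 1) - s n) ^ k := by
  have key : ∀ m : Multiset K, ∃ (c : Γ₀) (k : ℕ), c ≠ 0 ∧
      ∀ᶠ n in atTop, v ((m.map (fun x => X - C x)).prod.eval (s n))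
        = c * v (s (n + 1) - s n) ^ k := by
    intro m
    induction m using Multiset.induction_on with
    | empty => exact ⟨1, 0, one_ne_zero, by simp⟩
    | cons a m ih =>
      obtain ⟨c, k, hc, h⟩ := ih
      obtain ⟨c', k', hc', h'⟩ := hs.eventually_linear a
      refine ⟨c' * c, k' + k, mul_ne_zero hc' hc, ?_⟩
      filter_upwards [h, h'] with n h h'
      rw [Multiset.map_cons, Multiset.prod_cons, eval_mul, map_mul, h]
      simp only [eval_sub, eval_X, eval_C, h', pow_add]
      exact mul_mul_mul_comm _ _ _ _
  obtain ⟨c, k, hc, h⟩ := key p.roots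
  refine ⟨v p.leadingCoeff * c, k, mul_ne_zero ?_ hc, ?_⟩
  · simpa using hp0
  · filter_upwards [h] with n h
    conv_lhs => rw [hp.eq_prod_roots]
    rw [eval_mul, eval_C, map_mul, h, mul_assoc]

theorem eventually_eval_ne_zero (hs : IsPseudoConvergent v s) {p : K[X]} (hp : p ≠ 0) :
    ∀ᶠ n in atTop, p.eval (s n) ≠ 0 := by
  have hinj : Function.Injective s := by
    suffices hlt : ∀ m n, m < n → s m ≠ s n by
      intro m n h
      by_contra hmn
      rcases lt_or_gt_of_ne hmn with h' | h'
      · exact hlt _ _ h' h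
      · exact hlt _ _ h' h.symm
    intro m n hmn
    obtain ⟨k, rfl⟩ := Nat.exists_eq_add_of_le (Nat.succ_le_of_lt hmn)
    intro h
    apply hs.gauge_ne_zero m
    rw [← hs.val_sub m k, show m + 1 + k = m.succ + k from rfl, ← h, sub_self, map_zero]
  have hfin : {n | p.eval (s n) = 0}.Finite := by
    refine Set.Finite.of_finite_image (f := s) ((Multiset.finite_toSet p.roots).subset ?_)
      hinj.injOn
    rintro _ ⟨n, hn, rfl⟩
    simpa [hp] using hn
  have := hfin.compl_mem_cofinite
  rw [Nat.cofinite_eq_atTop] at this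
  exact this

theorem eventually_le_or_ge (hs : IsPseudoConvergent v s) {p q : K[X]} (hp : p ≠ 0) (hq : q ≠ 0) :
    (∀ᶠ n in atTop, v (p.eval (s n)) ≤ v (q.eval (s n))) ∨
      (∀ᶠ n in atTop, v (q.eval (s n)) ≤ v (p.eval (s n))) := by
  obtain ⟨A, hA⟩ := exists_extension v
  have ht := hs.map A.valuation
  set f := algebraMap K (AlgebraicClosure K) with hf
  have hmap : ∀ (r : K[X]) (n : ℕ), (r.map f).eval (f (s n)) = f (r.eval (s n)) := fun r n => by
    rw [eval_map, eval₂_at_apply]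
  have hne : ∀ {r : K[X]}, r ≠ 0 → r.map f ≠ 0 := fun h =>
    (Polynomial.map_ne_zero_iff f.injective).2 h
  obtain ⟨c, k, hc, h⟩ := ht.eventually_eval_of_splits (IsAlgClosed.splits (p.map f)) (hne hp)
  obtain ⟨c', k', hc', h'⟩ := ht.eventually_eval_of_splits (IsAlgClosed.splits (q.map f)) (hne hq)
  simp only [hmap] at h h'
  -- compare two monomials in the strictly decreasing gauge
  have mono : ∀ {Γ : Type _} [LinearOrderedCommGroupWithZero Γ] (d : ℕ → Γ), StrictAnti d →
      (∀ n, d n ≠ 0) → ∀ (a b : Γ) (i j : ℕ), i ≤ j →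
      (∀ᶠ n in atTop, a * d n ^ i ≤ b * d n ^ j) ∨ (∀ᶠ n in atTop, b * d n ^ j ≤ a * d n ^ i) := by
    intro Γ _ d hd hd0 a b i j hij
    obtain ⟨l, rfl⟩ := Nat.exists_eq_add_of_le hij
    by_cases hN : ∃ N, b * d N ^ l ≤ a
    · obtain ⟨N, hN⟩ := hN
      right
      filter_upwards [eventually_ge_atTop N] with n hn
      have : b * d n ^ l ≤ a :=
        (mul_le_mul_right (pow_le_pow_left' (hd.antitone hn) l) b).trans hN
      calc b * d n ^ (i + l) = (b * d n ^ l) * d n ^ i := by rw [pow_add]; ac_rfl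
        _ ≤ a * d n ^ i := mul_le_mul_left this _
    · push Not at hN
      left
      refine Eventually.of_forall fun n => ?_
      calc a * d n ^ i ≤ (b * d n ^ l) * d n ^ i := mul_le_mul_left (hN n).le _
        _ = b * d n ^ (i + l) := by rw [pow_add]; ac_rfl
  have hle : ∀ x y : K, v x ≤ v y ↔ A.valuation (f x) ≤ A.valuation (f y) := fun x y =>
    (Valuation.HasExtension.val_map_le_iff v A.valuation x y).symm
  simp only [hle]
  rcases le_total k k' with hk | hk
  · refine (mono _ ht.gauge_strictAnti ht.gauge_ne_zero c c' k k' hk).imp ?_ ?_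
    all_goals
      intro H
      filter_upwards [H, h, h'] with n H h h'
      rw [h, h']; exact H
  · refine (mono _ ht.gauge_strictAnti ht.gauge_ne_zero c' c k' k hk).symm.imp ?_ ?_
    all_goals
      intro H
      filter_upwards [H, h, h'] with n H h h'
      rw [h, h']; exact H

theorem eventually_denom (hs : IsPseudoConvergent v s) (φ : RatFunc K) :
    ∀ᶠ n in atTop, φ.denom.eval₂ (RingHom.id K) (s n) ≠ 0 := by
  simpa [eval₂_id] using hs.eventually_eval_ne_zero φ.denom_ne_zero

/-- The valuation domain `V_E` of `K(X)` attached to the pseudo-convergent sequence `E = (s n)`: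
the rational functions `φ` such that `φ (s n)` is defined and belongs to the valuation domain `V`
of `v` for all but finitely many `n`. -/
noncomputable def valuationRing (hs : IsPseudoConvergent v s) : ValuationSubring (RatFunc K) where
  carrier := {φ | ∀ᶠ n in atTop, φ.denom.eval (s n) ≠ 0 ∧
    φ.eval (RingHom.id K) (s n) ∈ v.valuationSubring}
  mul_mem' := by
    intro a b ha hb
    filter_upwards [ha, hb, hs.eventually_denom (a * b)] with n ha hb h
    rw [eval₂_id] at h
    refine ⟨h, ?_⟩
    rw [RatFunc.eval_mul _ _ (by rw [eval₂_id]; exact ha.1) (by rw [eval₂_id]; exact hb.1)]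
    exact mul_mem ha.2 hb.2
  one_mem' := Eventually.of_forall fun n => by simp [one_mem]
  add_mem' := by
    intro a b ha hb
    filter_upwards [ha, hb, hs.eventually_denom (a + b)] with n ha hb h
    rw [eval₂_id] at h
    refine ⟨h, ?_⟩
    rw [RatFunc.eval_add _ _ (by rw [eval₂_id]; exact ha.1) (by rw [eval₂_id]; exact hb.1)]
    exact add_mem ha.2 hb.2
  zero_mem' := Eventually.of_forall fun n => by simp [zero_mem]
  neg_mem' := by
    intro a ha
    have e : -a = RatFunc.C (-1) * a := by simp
    filter_upwards [ha, hs.eventually_denom (-a)] with n ha h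
    rw [eval₂_id] at h
    refine ⟨h, ?_⟩
    rw [e, RatFunc.eval_mul _ _ (by rw [RatFunc.denom_C]; simp) (by rw [eval₂_id]; exact ha.1), RatFunc.eval_C]
    exact mul_mem (by simp [one_mem]) ha.2
  mem_or_inv_mem' := by
    intro a
    by_cases ha : a = 0
    · subst ha
      exact Or.inl (Eventually.of_forall fun n => by simp [zero_mem])
    have hn := RatFunc.num_ne_zero ha
    refine (hs.eventually_le_or_ge hn a.denom_ne_zero).imp ?_ ?_
    · intro H
      filter_upwards [H, hs.eventually_denom a] with n H h
      rw [eval₂_id] at h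
      refine ⟨h, ?_⟩
      rw [Valuation.mem_valuationSubring_iff, RatFunc.eval, eval₂_id, eval₂_id, map_div₀]
      exact div_le_one_of_le₀ H zero_le
    · intro H
      filter_upwards [H, hs.eventually_denom a, hs.eventually_denom a⁻¹,
        hs.eventually_eval_ne_zero hn] with n H h h' hnum
      have hmul := RatFunc.eval_mul (RingHom.id K) (s n) h h'
      rw [mul_inv_cancel₀ ha, RatFunc.eval_one] at hmul
      have hinv : a⁻¹.eval (RingHom.id K) (s n) = (a.eval (RingHom.id K) (s n))⁻¹ :=
        eq_inv_of_mul_eq_one_right hmul.symm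
      rw [eval₂_id] at h h'
      refine ⟨h', ?_⟩
      rw [hinv, Valuation.mem_valuationSubring_iff, RatFunc.eval, eval₂_id, eval₂_id, map_inv₀,
        map_div₀, inv_div]
      exact div_le_one_of_le₀ H zero_le

/-- `V_E` contains `V`, so it is a point of `Zar(K(X)|V)`. -/
noncomputable def toZar (hs : IsPseudoConvergent v s) : Zar v.valuationSubring (RatFunc K) :=
  ⟨hs.valuationRing, fun a => Eventually.of_forall fun n => by
    have e : algebraMap v.valuationSubring (RatFunc K) a = RatFunc.C (a : K) := by
      rw [← RatFunc.algebraMap_eq_C]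
      exact IsScalarTower.algebraMap_apply v.valuationSubring K (RatFunc K) a
    rw [e, RatFunc.eval_C]
    exact ⟨by simp, a.2⟩⟩

end IsPseudoConvergent

/-- The set `𝒱ᵘ(β,•)` of the valuation domains `V_E`, for `E ⊆ K` a pseudo-convergent sequence
(with respect to `v`) that has `β` as a pseudo-limit with respect to `u`. -/
def fixedPseudoLimit (v : Valuation K Γ₀) {L : Type*} [Field L] [Algebra K L] {Γ : Type*}
    [LinearOrderedCommGroupWithZero Γ] (u : Valuation L Γ) (β : L) :
    Set (Zar v.valuationSubring (RatFunc K)) :=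
  {W | ∃ (s : ℕ → K) (hs : IsPseudoConvergent v s), IsPseudoLimit u s β ∧ W = hs.toZar}

end Sequences

end ZarSpace

/-!
The constructible topology is finer than the Zariski topology, so it suffices to show that, inside
`𝒱ᵘ(β,•)`, the complement of each `B(φ)` is a Zariski neighbourhood of each of its points `V_E`.

Let `φ ∉ V_E`. By the ultrametric inequality, the value of a nonzero polynomial at `x` depends only
on the distance `t = u (β - x)`, as a monomial `c * t ^ k`, as long as `t` stays in an open
interval containing no distance from `β` to a root of the polynomial
(`exists_eval_eq_mul_pow`). Choose such an interval `(b, a)` for the numerator and the denominator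
of `φ`, where `b` is the largest root distance (or `0`) below all the distances from `β` to `E` and
`a` is a distance from `β` to a member of `E`.
The requirement that a sequence `E'` with pseudo-limit `β` eventually stays at distance less than
`a` from `β` is one condition `ψ ∈ V_{E'}`. That it stays at distance greater than `b` is either
automatic or one such condition as well: values of `u` are torsion over the values of `v`
(`exists_pow_eq_map_algebraMap`), so a power of `b` is the value of some element of `K`
(`exists_nhd_lower_bound`). If moreover `φ⁻¹ ∈ V_{E'}`, then `φ ∈ V_{E'}` would make two
monomials agree at infinitely many distances in `(b, a)`; they would then be the same monomial,
and `φ` would have value `1` along `E`, contradicting `φ ∉ V_E`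
(`exists_finset_separating`).
-/

namespace ZarSpace

/-! ### Valuations on an algebraic extension -/

section Extension

variable {K : Type*} [Field K] {Γ₀ : Type*} [LinearOrderedCommGroupWithZero Γ₀]
  {L : Type*} [Field L] [Algebra K L] {Γ : Type*} [LinearOrderedCommGroupWithZero Γ]

/-- On an algebraic extension every value is torsion over the values of the base field: in an
algebraic equation, two terms must have the same value. -/
theorem exists_pow_eq_map_algebraMap [Algebra.IsAlgebraic K L] (u : Valuation L Γ) {γ : L}
    (hγ : γ ≠ 0) : ∃ (e : ℕ) (d : K), e ≠ 0 ∧ u γ ^ e = u (algebraMap K L d) := by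
  classical
  obtain ⟨p, hp0, hp⟩ := Algebra.IsAlgebraic.isAlgebraic (R := K) γ
  set f : ℕ → L := fun i => algebraMap K L (p.coeff i) * γ ^ i with hf
  have hsum : ∑ i ∈ p.support, f i = 0 := by
    rw [← hp, aeval_def, eval₂_eq_sum, Polynomial.sum_def]
  obtain ⟨j, hj, hmax⟩ := p.support.exists_max_image (fun i => u (f i))
    (Polynomial.support_nonempty.2 hp0)
  have hf0 : ∀ i ∈ p.support, f i ≠ 0 := fun i hi =>
    mul_ne_zero (by simpa using hi) (pow_ne_zero _ hγ)
  have : ∃ i ∈ p.support, i ≠ j ∧ u (f i) = u (f j) := by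
    by_contra! h
    have := u.map_sum_eq_of_lt (f := f) hj (fun i hi => by
      have hi' : i ∈ p.support ∧ i ≠ j := by simpa using hi
      exact lt_of_le_of_ne (hmax i hi'.1) (h i hi'.1 hi'.2))
    rw [hsum, map_zero] at this
    exact hf0 j hj (u.zero_iff.1 this.symm)
  obtain ⟨i, hi, hij, h⟩ := this
  have hu : u γ ≠ 0 := u.ne_zero_iff.2 hγ
  have key : ∀ i j, i < j → i ∈ p.support → j ∈ p.support → u (f i) = u (f j) →
      ∃ (e : ℕ) (d : K), e ≠ 0 ∧ u γ ^ e = u (algebraMap K L d) := by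
    intro i j hij hi hj h
    obtain ⟨l, rfl⟩ := Nat.exists_eq_add_of_lt hij
    refine ⟨l + 1, p.coeff i / p.coeff (i + l + 1), by omega, ?_⟩
    have hc : u (algebraMap K L (p.coeff (i + l + 1))) ≠ 0 := by
      simpa using hj
    rw [map_div₀, map_div₀, eq_div_iff hc]
    simp only [hf, map_mul, map_pow] at h
    rw [show i + l + 1 = l + 1 + i by omega] at h ⊢
    rw [pow_add, ← mul_assoc] at h
    rw [mul_comm]
    exact (mul_right_cancel₀ (pow_ne_zero i hu) h).symm
  rcases lt_or_gt_of_ne hij with h' | h'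
  · exact key i j h' hi hj h
  · exact key j i h' hj hi h.symm

/-- The value of a polynomial at `x` is a monomial in the distance from `x` to `β`, as long as this
distance stays in an open interval containing no distance from `β` to a root. -/
theorem exists_eval_eq_mul_pow [IsAlgClosed L] (u : Valuation L Γ) (β : L) {p : L[X]} (hp : p ≠ 0)
    {b a : Γ} (hba : ∀ α ∈ p.roots, u (β - α) ≤ b ∨ a ≤ u (β - α)) :
    ∃ (c : Γ) (k : ℕ), c ≠ 0 ∧
      ∀ x, b < u (β - x) → u (β - x) < a → u (p.eval x) = c * u (β - x) ^ k := by
  have key : ∀ m : Multiset L, (∀ α ∈ m, u (β - α) ≤ b ∨ a ≤ u (β - α)) → b < a →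
      ∃ (c : Γ) (k : ℕ), c ≠ 0 ∧ ∀ x, b < u (β - x) → u (β - x) < a →
        u ((m.map (fun x => X - C x)).prod.eval x) = c * u (β - x) ^ k := by
    intro m hm hlt
    induction m using Multiset.induction_on with
    | empty => exact ⟨1, 0, one_ne_zero, by simp⟩
    | cons α m ih =>
      obtain ⟨c, k, hc, h⟩ := ih fun α' h' => hm α' (Multiset.mem_cons_of_mem h')
      have e : ∀ x, x - α = (β - α) - (β - x) := fun x => by ring
      rcases hm α (Multiset.mem_cons_self _ _) with hα | hα
      · refine ⟨c, k + 1, hc, fun x hx hx' => ?_⟩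
        rw [Multiset.map_cons, Multiset.prod_cons, eval_mul, map_mul, h x hx hx', eval_sub, eval_X,
          eval_C, e, u.map_sub_eq_of_lt_right (hα.trans_lt hx), pow_succ']
        exact mul_left_comm _ _ _
      · refine ⟨u (β - α) * c, k, mul_ne_zero ?_ hc, fun x hx hx' => ?_⟩
        · exact (zero_le.trans_lt (hlt.trans_le hα)).ne'
        rw [Multiset.map_cons, Multiset.prod_cons, eval_mul, map_mul, h x hx hx', eval_sub, eval_X,
          eval_C, e, u.map_sub_eq_of_lt_left (hx'.trans_le hα), mul_assoc]
  by_cases hlt : b < a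
  · obtain ⟨c, k, hc, h⟩ := key p.roots hba hlt
    refine ⟨u p.leadingCoeff * c, k, mul_ne_zero (by simpa using hp) hc, fun x hx hx' => ?_⟩
    conv_lhs => rw [(IsAlgClosed.splits p).eq_prod_roots]
    rw [eval_mul, eval_C, map_mul, h x hx hx', mul_assoc]
  · exact ⟨1, 0, one_ne_zero, fun x hx hx' => absurd (hx.trans hx') hlt⟩

end Extension

/-- Two monomials that agree at two distinct nonzero points are equal. -/
theorem monomial_eq_of_eq_of_lt {Γ : Type*} [LinearOrderedCommGroupWithZero Γ] {c c' t t' : Γ}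
    {k k' : ℕ} (hc : c ≠ 0) (hc' : c' ≠ 0) (ht' : t' ≠ 0) (hlt : t' < t)
    (h : c * t ^ k = c' * t ^ k') (h' : c * t' ^ k = c' * t' ^ k') : c = c' ∧ k = k' := by
  have ht : t ≠ 0 := (zero_le.trans_lt hlt).ne'
  have key : ∀ (c c' : Γ) (k l : ℕ), c' ≠ 0 → c * t ^ k = c' * t ^ (k + l + 1) →
      c * t' ^ k = c' * t' ^ (k + l + 1) → False := by
    intro c c' k l hc' h h'
    have cancel : ∀ {x : Γ}, x ≠ 0 → c * x ^ k = c' * x ^ (k + l + 1) → c = c' * x ^ (l + 1) :=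
      fun {x} hx h => by
        apply mul_right_cancel₀ (pow_ne_zero k hx)
        rw [h, add_assoc, pow_add, mul_comm (x ^ k), mul_assoc]
    have e := mul_left_cancel₀ hc' ((cancel ht h).symm.trans (cancel ht' h'))
    exact (pow_lt_pow_left₀ hlt zero_le (by omega)).ne' e
  rcases lt_trichotomy k k' with hk | rfl | hk
  · obtain ⟨l, rfl⟩ := Nat.exists_eq_add_of_lt hk
    exact (key _ _ _ _ hc' h h').elim
  · exact ⟨mul_right_cancel₀ (pow_ne_zero k ht) h, rfl⟩
  · obtain ⟨l, rfl⟩ := Nat.exists_eq_add_of_lt hk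
    exact (key _ _ _ _ hc h.symm h'.symm).elim

/-! ### Membership in `V_E` and distances to a pseudo-limit -/

section Sequences

variable {K : Type*} [Field K] {Γ₀ : Type*} [LinearOrderedCommGroupWithZero Γ₀]
  {v : Valuation K Γ₀} {s : ℕ → K}
  {L : Type*} [Field L] [Algebra K L] {Γ : Type*} [LinearOrderedCommGroupWithZero Γ]
  {u : Valuation L Γ} {β : L}

theorem IsPseudoConvergent.div_mem_valuationRing_iff (hs : IsPseudoConvergent v s) (p : K[X])
    {q : K[X]} (hq : q ≠ 0) :
    algebraMap K[X] (RatFunc K) p / algebraMap K[X] (RatFunc K) q ∈ hs.valuationRing ↔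
      ∀ᶠ n in atTop, v (p.eval (s n)) ≤ v (q.eval (s n)) := by
  set φ := algebraMap K[X] (RatFunc K) p / algebraMap K[X] (RatFunc K) q with hφ
  have hcross : φ.num * q = p * φ.denom := by
    apply RatFunc.algebraMap_injective K
    rw [map_mul, map_mul, ← div_eq_div_iff (RatFunc.algebraMap_ne_zero φ.denom_ne_zero)
      (RatFunc.algebraMap_ne_zero hq), RatFunc.num_div_denom]
  change (∀ᶠ n in atTop, φ.denom.eval (s n) ≠ 0 ∧
    φ.eval (RingHom.id K) (s n) ∈ v.valuationSubring) ↔ _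
  have hmem : ∀ᶠ n in atTop, (φ.denom.eval (s n) ≠ 0 ∧
      φ.eval (RingHom.id K) (s n) ∈ v.valuationSubring) ↔
        v (p.eval (s n)) ≤ v (q.eval (s n)) := by
    filter_upwards [hs.eventually_eval_ne_zero φ.denom_ne_zero, hs.eventually_eval_ne_zero hq]
      with n hd hqn
    have he := congrArg (eval (s n)) hcross
    rw [eval_mul, eval_mul] at he
    rw [and_iff_right hd, Valuation.mem_valuationSubring_iff, RatFunc.eval, eval₂_id, eval₂_id,
      (div_eq_div_iff hd hqn).2 he, map_div₀, div_le_one₀ (v.pos_iff.2 hqn)]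
  exact eventually_congr hmem

theorem IsPseudoLimit.dist_strictAnti (hβ : IsPseudoLimit u s β) :
    StrictAnti fun n => u (β - algebraMap K L (s n)) :=
  strictAnti_nat_of_succ_lt hβ

theorem IsPseudoLimit.dist_pos (hβ : IsPseudoLimit u s β) (n : ℕ) :
    0 < u (β - algebraMap K L (s n)) :=
  zero_le.trans_lt (hβ n)

theorem IsPseudoLimit.dist_eq (hβ : IsPseudoLimit u s β) {n m : ℕ} (h : n < m) :
    u (algebraMap K L (s m - s n)) = u (β - algebraMap K L (s n)) := by
  rw [map_sub (algebraMap K L), ← sub_sub_sub_cancel_left _ _ β,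
    u.map_sub_eq_of_lt_left (hβ.dist_strictAnti h)]

/-! ### Zariski neighbourhoods bounding the distance to the pseudo-limit -/

/-- One condition `ψ ∈ V_{E'}`, satisfied by `E`, forces a sequence `E'` to come eventually closer
to `β` than the member `s N` of `E`; one takes `ψ = (X - s N) / (s (N + 1) - s N)`. -/
theorem exists_nhd_upper_bound [v.HasExtension u] (hs : IsPseudoConvergent v s)
    (hβ : IsPseudoLimit u s β) (N : ℕ) :
    ∃ ψ ∈ hs.valuationRing, ∀ (s' : ℕ → K) (hs' : IsPseudoConvergent v s'),
      IsPseudoLimit u s' β → ψ ∈ hs'.valuationRing →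
        ∀ᶠ n in atTop, u (β - algebraMap K L (s' n)) < u (β - algebraMap K L (s N)) := by
  have hne : s (N + 1) - s N ≠ 0 := v.ne_zero_iff.1 (hs.gauge_ne_zero N)
  have hmem : ∀ (s' : ℕ → K) (hs' : IsPseudoConvergent v s'), _ :=
    fun s' hs' => hs'.div_mem_valuationRing_iff (X - C (s N)) (C_ne_zero.2 hne)
  simp only [eval_sub, eval_X, eval_C, ← Valuation.HasExtension.val_map_le_iff v u,
    hβ.dist_eq N.lt_succ_self] at hmem
  refine ⟨_, (hmem s hs).2 ?_, fun s' hs' hβ' h => ?_⟩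
  · filter_upwards [eventually_gt_atTop N] with n hn
    rw [hβ.dist_eq hn]
  · obtain ⟨M, hM⟩ := ((hmem s' hs').1 h).exists
    filter_upwards [eventually_gt_atTop M] with n hn
    refine lt_of_lt_of_le (hβ'.dist_strictAnti hn) ?_
    beta_reduce
    rw [show β - algebraMap K L (s' M) = (β - algebraMap K L (s N))
      - algebraMap K L (s' M - s N) by rw [map_sub]; ring]
    exact u.map_sub_le le_rfl hM

/-- If the members of `E` are farther than `u γ` from `β`, then one condition `ψ ∈ V_{E'}`, satisfied
by `E`, forces a sequence `E'` to stay farther than `u γ` from `β`. If some `x ∈ K` is closer than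
`u γ` to `β`, one takes `ψ = d / (X - x) ^ e` with `u γ ^ e = u d`. -/
theorem exists_nhd_lower_bound [v.HasExtension u] [Algebra.IsAlgebraic K L]
    (hs : IsPseudoConvergent v s) (γ : L)
    (hγ : ∀ n, u γ < u (β - algebraMap K L (s n))) :
    ∃ ψ ∈ hs.valuationRing, ∀ (s' : ℕ → K) (hs' : IsPseudoConvergent v s'),
      IsPseudoLimit u s' β → ψ ∈ hs'.valuationRing →
        ∀ n, u γ < u (β - algebraMap K L (s' n)) := by
  by_cases hx : ∃ x : K, u (β - algebraMap K L x) < u γ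
  · obtain ⟨x, hx⟩ := hx
    obtain ⟨e, d, he, hd⟩ := exists_pow_eq_map_algebraMap (K := K) u
      (u.pos_iff.1 (zero_le.trans_lt hx))
    have hq : (X - C x) ^ e ≠ 0 := pow_ne_zero _ (X_sub_C_ne_zero x)
    have hmem : ∀ (s' : ℕ → K) (hs' : IsPseudoConvergent v s'), _ :=
      fun s' hs' => hs'.div_mem_valuationRing_iff (C d) hq
    simp only [eval_pow, eval_sub, eval_X, eval_C, ← Valuation.HasExtension.val_map_le_iff v u,
      ← hd] at hmem
    simp only [map_pow, pow_le_pow_iff_left₀ (zero_le (a := u γ)) zero_le he] at hmem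
    have hsub : ∀ y : K, algebraMap K L (y - x)
        = (β - algebraMap K L x) - (β - algebraMap K L y) := fun y => by
      rw [map_sub]; ring
    refine ⟨_, (hmem s hs).2 (Eventually.of_forall fun n => ?_), fun s' hs' hβ' h n => ?_⟩
    · rw [hsub, u.map_sub_eq_of_lt_right (hx.trans (hγ n))]
      exact (hγ n).le
    · obtain ⟨M, hM, hnM⟩ := (((hmem s' hs').1 h).and (eventually_gt_atTop n)).exists
      refine lt_of_le_of_lt ?_ (hβ'.dist_strictAnti hnM)
      by_contra! hlt
      rw [hsub] at hM
      exact hM.not_gt (u.map_sub_lt hx hlt)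
  · -- no point of `K` is closer than `u γ` to `β`, so nothing has to be required
    push Not at hx
    exact ⟨1, one_mem _, fun s' _ hβ' _ n => (hx _).trans_lt (hβ' n)⟩

/-! ### Separation of `V_E` from `B(φ)` -/

/-- Given finitely many elements of `L`, the distances from `β` to `E` eventually lie in an interval
that contains none of the distances from `β` to the given elements. -/
theorem IsPseudoLimit.exists_gap (hβ : IsPseudoLimit u s β) (m : Multiset L) :
    ∃ (γ : L) (N : ℕ), (∀ n, u γ < u (β - algebraMap K L (s n))) ∧
      ∀ α ∈ m, u (β - α) ≤ u γ ∨ u (β - algebraMap K L (s N)) ≤ u (β - α) := by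
  induction m using Multiset.induction_on with
  | empty => exact ⟨0, 0, fun n => by simpa using hβ.dist_pos n, by simp⟩
  | cons α m ih =>
    obtain ⟨γ, N, hγ, h⟩ := ih
    by_cases hα : ∀ n, u (β - α) < u (β - algebraMap K L (s n))
    · rcases le_total (u (β - α)) (u γ) with hle | hle
      · exact ⟨γ, N, hγ, Multiset.forall_mem_cons.2 ⟨Or.inl hle, h⟩⟩
      · exact ⟨β - α, N, hα, Multiset.forall_mem_cons.2
          ⟨Or.inl le_rfl, fun α' h' => (h α' h').imp_left hle.trans'⟩⟩
    · push Not at hα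
      obtain ⟨M, hM⟩ := hα
      refine ⟨γ, max M N, hγ, Multiset.forall_mem_cons.2 ⟨Or.inr ?_, fun α' h' => ?_⟩⟩
      · exact (hβ.dist_strictAnti.antitone (le_max_left M N)).trans hM
      · exact (h α' h').imp_right (hβ.dist_strictAnti.antitone (le_max_right M N)).trans

/-- If `φ ∉ V_E`, then finitely many conditions `ψ ∈ V_{E'}` satisfied by `E` force
`φ ∉ V_{E'}`. -/
theorem exists_finset_separating [v.HasExtension u] [IsAlgClosed L] [Algebra.IsAlgebraic K L]
    (hs : IsPseudoConvergent v s) (hβ : IsPseudoLimit u s β) {φ : RatFunc K}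
    (hφ : φ ∉ hs.valuationRing) :
    ∃ T : Finset (RatFunc K), (∀ ψ ∈ T, ψ ∈ hs.valuationRing) ∧
      ∀ (s' : ℕ → K) (hs' : IsPseudoConvergent v s'), IsPseudoLimit u s' β →
        (∀ ψ ∈ T, ψ ∈ hs'.valuationRing) → φ ∉ hs'.valuationRing := by
  classical
  set f := algebraMap K L with hf
  have hφ0 : φ ≠ 0 := by rintro rfl; exact hφ (zero_mem _)
  have hmap : ∀ (r : K[X]) (x : K), (r.map f).eval (f x) = f (r.eval x) := fun r x => by
    rw [eval_map, eval₂_at_apply]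
  have hp : φ.num.map f ≠ 0 :=
    (Polynomial.map_ne_zero_iff f.injective).2 (RatFunc.num_ne_zero hφ0)
  have hq : φ.denom.map f ≠ 0 := (Polynomial.map_ne_zero_iff f.injective).2 φ.denom_ne_zero
  obtain ⟨γ, N, hγ, hgap⟩ := hβ.exists_gap ((φ.num.map f).roots + (φ.denom.map f).roots)
  obtain ⟨c, k, hc, hnum⟩ := exists_eval_eq_mul_pow u β hp
    fun α hα => hgap α (Multiset.mem_add.2 (Or.inl hα))
  obtain ⟨c', k', hc', hden⟩ := exists_eval_eq_mul_pow u β hq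
    fun α hα => hgap α (Multiset.mem_add.2 (Or.inr hα))
  have hmem : ∀ (s' : ℕ → K) (hs' : IsPseudoConvergent v s'), φ ∈ hs'.valuationRing ↔
      ∀ᶠ n in atTop, u (f (φ.num.eval (s' n))) ≤ u (f (φ.denom.eval (s' n))) := by
    intro s' hs'
    have := hs'.div_mem_valuationRing_iff φ.num φ.denom_ne_zero
    rw [RatFunc.num_div_denom] at this
    simpa only [hf, Valuation.HasExtension.val_map_le_iff v u] using this
  have hmem' : ∀ (s' : ℕ → K) (hs' : IsPseudoConvergent v s'), φ⁻¹ ∈ hs'.valuationRing ↔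
      ∀ᶠ n in atTop, u (f (φ.denom.eval (s' n))) ≤ u (f (φ.num.eval (s' n))) := by
    intro s' hs'
    have := hs'.div_mem_valuationRing_iff φ.denom (RatFunc.num_ne_zero hφ0)
    rw [← inv_div, RatFunc.num_div_denom] at this
    simpa only [hf, Valuation.HasExtension.val_map_le_iff v u] using this
  obtain ⟨ψ, hψ, hψ'⟩ := exists_nhd_upper_bound hs hβ N
  obtain ⟨χ, hχ, hχ'⟩ := exists_nhd_lower_bound (u := u) hs γ hγ
  have hinv : φ⁻¹ ∈ hs.valuationRing := (hs.valuationRing.mem_or_inv_mem φ).resolve_left hφ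
  refine ⟨{ψ, χ, φ⁻¹}, by simp [hψ, hχ, hinv], fun s' hs' hβ' hT hmemφ => hφ ?_⟩
  have hupper := hψ' s' hs' hβ' (hT ψ (by simp))
  have hlower := hχ' s' hs' hβ' (hT χ (by simp))
  have hle := (hmem s' hs').1 hmemφ
  have hge := (hmem' s' hs').1 (hT φ⁻¹ (by simp))
  -- along `E'` the numerator and the denominator have the same value
  have heq : ∀ᶠ n in atTop, c * u (β - f (s' n)) ^ k = c' * u (β - f (s' n)) ^ k' := by
    filter_upwards [hupper, hle, hge] with n h1 h2 h3
    rw [← hnum _ (hlower n) h1, ← hden _ (hlower n) h1, hmap, hmap]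
    exact le_antisymm h2 h3
  obtain ⟨M, hM⟩ := eventually_atTop.1 heq
  obtain ⟨rfl, rfl⟩ := monomial_eq_of_eq_of_lt hc hc' (hβ'.dist_pos (M + 1)).ne' (hβ' M)
    (hM M le_rfl) (hM (M + 1) (by omega))
  refine (hmem s hs).2 ?_
  filter_upwards [eventually_gt_atTop N] with n hn
  have hlt := hβ.dist_strictAnti hn
  rw [← hmap, ← hmap, hnum _ (hγ n) hlt, hden _ (hγ n) hlt]

end Sequences

/-! ### Comparison of the topologies -/

theorem constructibleTopology_le_zariskiTopology (D L : Type*) [CommRing D] [Field L]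
    [Algebra D L] : constructibleTopology D L ≤ zariskiTopology D L := by
  refine le_generateFrom ?_
  rintro _ ⟨φ, rfl⟩
  exact TopologicalSpace.isOpen_generateFrom_of_mem ⟨{φ}, Or.inl (by simp)⟩

/-- The two topologies agree on a subspace on which the complement of every `B(φ)` is Zariski
open, that is, contains a basic Zariski neighbourhood of each of its points. -/
theorem induced_zariskiTopology_eq {D L : Type*} [CommRing D] [Field L] [Algebra D L]
    {S : Set (Zar D L)}
    (hS : ∀ W ∈ S, ∀ φ, φ ∉ W.1 → ∃ T : Finset L, (∀ ψ ∈ T, ψ ∈ W.1) ∧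
      ∀ W' ∈ S, (∀ ψ ∈ T, ψ ∈ W'.1) → φ ∉ W'.1) :
    (zariskiTopology D L).induced (Subtype.val : S → _) =
      (constructibleTopology D L).induced (Subtype.val : S → _) := by
  refine le_antisymm ?_ (induced_mono (constructibleTopology_le_zariskiTopology D L))
  let : TopologicalSpace S := (zariskiTopology D L).induced Subtype.val
  have hB : ∀ φ, IsOpen (Subtype.val ⁻¹' B D L φ : Set S) := fun φ =>
    ⟨_, TopologicalSpace.isOpen_generateFrom_of_mem ⟨φ, rfl⟩, rfl⟩
  have hfin : ∀ T : Finset L, IsOpen (Subtype.val ⁻¹' (⋂ φ ∈ T, B D L φ) : Set S) := fun T => by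
    simp only [Set.preimage_iInter]
    exact isOpen_biInter_finset fun φ _ => hB φ
  have hBc : ∀ φ, IsOpen (Subtype.val ⁻¹' (B D L φ)ᶜ : Set S) := fun φ => by
    refine isOpen_iff_forall_mem_open.2 fun W hW => ?_
    obtain ⟨T, hT, hT'⟩ := hS W.1 W.2 φ hW
    refine ⟨_, fun W' hW' => ?_, hfin T, ?_⟩
    · exact hT' W'.1 W'.2 (by simpa [B] using hW')
    · simpa [B] using hT
  refine le_of_le_of_eq (le_generateFrom ?_) induced_generateFrom_eq.symm
  rintro _ ⟨_, ⟨T, rfl | rfl⟩, rfl⟩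
  · exact hfin T
  · simp only [Set.compl_iInter, Set.preimage_iUnion]
    exact isOpen_biUnion fun φ _ => hBc φ

end ZarSpace

/-- Let `v` be a rank one valuation of a field `K`, with valuation domain `V`, let `u` be an
extension of `v` to an algebraic closure of `K`, and let `β` be in that algebraic closure. Then the
Zariski and the constructible topology of `Zar(K(X)|V)` induce the same topology on the set of the
`V_E`, for `E` a pseudo-convergent sequence in `K` with pseudo-limit `β` with respect to `u`. -/
theorem mainTheorem8 {K : Type*} [Field K] {Γ₀ : Type*} [LinearOrderedCommGroupWithZero Γ₀]
    (v : Valuation K Γ₀) [v.RankOne]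
    {Kbar : Type*} [Field Kbar] [Algebra K Kbar] [IsAlgClosure K Kbar]
    {Γ : Type*} [LinearOrderedCommGroupWithZero Γ] (u : Valuation Kbar Γ) [v.HasExtension u]
    (β : Kbar) :
    (ZarSpace.zariskiTopology v.valuationSubring (RatFunc K)).induced
        (Subtype.val : ZarSpace.fixedPseudoLimit v u β → _) =
      (ZarSpace.constructibleTopology v.valuationSubring (RatFunc K)).induced
        (Subtype.val : ZarSpace.fixedPseudoLimit v u β → _) := by
  have : IsAlgClosed Kbar := IsAlgClosure.isAlgClosed K
  have : Algebra.IsAlgebraic K Kbar := IsAlgClosure.isAlgebraic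
  refine ZarSpace.induced_zariskiTopology_eq ?_
  rintro _ ⟨s, hs, hβ, rfl⟩ φ hφ
  obtain ⟨T, hT, hT'⟩ := ZarSpace.exists_finset_separating hs hβ hφ
  refine ⟨T, hT, ?_⟩
  rintro _ ⟨s', hs', hβ', rfl⟩ h
  exact hT' s' hs' hβ' h
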